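/- Let $S$ be the set consisting of the infinite place $\infty$ and a finite (possibly empty) set $S_f$ of primes, and let $d\ge 2$. Put $\mathbb Q_\infty=\mathbb R$, $\mathbb Q_S=\mathbb R\times\prod_{p\in S_f}\mathbb Q_p$, and let $$\mathbb Z_S=\{(z,\dots,z)\in\mathbb Q_S:\ z\in\mathbb Q,\ |z|_p\le 1\text{ for every prime }p\notin S_f\}.$$ Let $\mu$ be the product measure on $\mathbb Q_S^d$ obtained from Lebesgue measure on $\mathbb R$ and the Haar measures $\mu_p$ on $\mathbb Q_p$ with $\mu_p(\mathbb Z_p)=1$, $p\in S_f$. Let either * $\mathsf G=\mathrm{UL}_d(\mathbb Q_S)=\{\mathsf g=(g_p)_{p\in S}\in \mathrm{GL}_d(\mathbb Q_S):\ \det g_\infty=1,\ |\det g_p|_p=1\ (p\in S_f)\}$, or * $\mathsf G=\mathrm{SL}_d(\mathbb Q_S)$, let $\Gamma$ be the group of those elements of $\mathsf G$ whose entries lie in $\mathbb Z_S$, and let $m$ be the $\mathsf G$-invariant Borel probability measure on $\mathsf G/\Gamma$. For $f:\mathbb Q_S^d\to[0,\infty]$ let $\widetilde f(\mathsf g\Gamma)=\sum_{\mathbf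 v\in \mathsf g\mathbb Z_S^d\setminus\{\mathbf 0\}}f(\mathbf v)\in[0,\infty]$, and write $I_A$ for the indicator function of a set $A$. **Theorem.** Let $\mathfrak F$ be a family of $\mu$-measurable sets $A\subseteq\mathbb Q_S^d$ with $0<\mu(A)<\infty$, and suppose that there is a constant $C_{\mathfrak F}>0$ such that $$\int_{\mathsf G/\Gamma}\widetilde{I_A}^{\,2}\,dm\le \mu(A)^2+C_{\mathfrak F}\,\mu(A)\qquad\text{for all }A\in\mathfrak F.$$ Then for every $A\in\mathfrak F$, $$m\bigl(\{\mathsf g\Gamma\in\mathsf G/\Gamma:\ (\mathsf g\mathbb Z_S^d\setminus\{\mathbf 0\})\cap A=\emptyset\}\bigr)\le\frac{C_{\mathfrak F}}{\mu(A)}.$$ -/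

import Mathlib

open MeasureTheory
open scoped ENNReal

noncomputable section

namespace SArithmetic

instance factPrime (p : Nat.Primes) : Fact (p : ℕ).Prime := ⟨p.2⟩

/-- The Borel `σ`-algebra on `ℚ_p`. -/
instance padicMeasurableSpace (p : ℕ) [Fact p.Prime] : MeasurableSpace ℚ_[p] := borel _

instance padicBorelSpace (p : ℕ) [Fact p.Prime] : BorelSpace ℚ_[p] := ⟨rfl⟩

/-- `ℤ_p = {x ∈ ℚ_p : |x|_p ≤ 1}`, as a compact set with nonempty interior. -/
def padicUnitBall (p : ℕ) [Fact p.Prime] : TopologicalSpace.PositiveCompacts ℚ_[p] where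
  carrier := Metric.closedBall 0 1
  isCompact' := isCompact_closedBall 0 1
  interior_nonempty' :=
    ⟨0, Metric.ball_subset_interior_closedBall (Metric.mem_ball_self one_pos)⟩

/-- The Haar measure `μ_p` on `ℚ_p`, normalized by `μ_p(ℤ_p) = 1`. -/
def padicHaar (p : ℕ) [Fact p.Prime] : Measure ℚ_[p] :=
  Measure.addHaarMeasure (padicUnitBall p)

/-- `ℚ_S = ℝ × ∏_{p ∈ S} ℚ_p`, where the finite set `S` consists of the finite places only:
the infinite place always belongs to the set of places that is considered. -/
abbrev QS (S : Finset Nat.Primes) : Type := ℝ × (∀ p : S, ℚ_[(p.1 : ℕ)])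

/-- The measure `μ = ∏ μ_p` on `ℚ_S`, with Lebesgue measure on `ℝ`. -/
def muQS (S : Finset Nat.Primes) : Measure (QS S) :=
  (volume : Measure ℝ).prod (Measure.pi fun p : S => padicHaar (p.1 : ℕ))

/-- The product measure `μ` on `ℚ_S ^ d`. -/
def mu (S : Finset Nat.Primes) (d : ℕ) : Measure (Fin d → QS S) :=
  Measure.pi fun _ => muQS S

/-- The diagonal embedding `z ↦ (z, …, z)` of `ℚ` into `ℚ_S`. -/
def diagEmb (S : Finset Nat.Primes) : ℚ →+* QS S :=
  (Rat.castHom ℝ).prod (RingHom.pi fun p : S => Rat.castHom ℚ_[(p.1 : ℕ)])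

/-- The rational numbers `z` with `|z|_p ≤ 1` for every prime `p ∉ S`. -/
def ratSIntegers (S : Finset Nat.Primes) : Subring ℚ where
  carrier := {z | ∀ p : Nat.Primes, p ∉ S → ‖(z : ℚ_[(p : ℕ)])‖ ≤ 1}
  mul_mem' := by
    intro a b ha hb p hp
    rw [Rat.cast_mul, norm_mul]
    exact mul_le_one₀ (ha p hp) (norm_nonneg _) (hb p hp)
  one_mem' := by intro p _; simp
  add_mem' := by
    intro a b ha hb p hp
    rw [Rat.cast_add]
    exact (Padic.nonarchimedean _ _).trans (max_le (ha p hp) (hb p hp))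
  zero_mem' := by intro p _; simp
  neg_mem' := by
    intro a ha p hp
    rw [Rat.cast_neg, norm_neg]
    exact ha p hp

/-- The ring `ℤ_S` of `S`-integers, embedded diagonally in `ℚ_S`. -/
def ZS (S : Finset Nat.Primes) : Subring (QS S) := (ratSIntegers S).map (diagEmb S)

/-- `GL_d(ℚ_S)`, with its usual topology as a group of units. -/
abbrev GLS (S : Finset Nat.Primes) (d : ℕ) : Type := GL (Fin d) (QS S)

/-- `UL_d(ℚ_S)`: the elements of `GL_d(ℚ_S)` with `det g_∞ = 1` and `|det g_p|_p = 1` for each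
prime `p ∈ S`. -/
def UL (S : Finset Nat.Primes) (d : ℕ) : Subgroup (GLS S d) where
  carrier := {g | (g.det : QS S).1 = 1 ∧ ∀ p : S, ‖(g.det : QS S).2 p‖ = 1}
  mul_mem' := by
    rintro a b ⟨ha, ha'⟩ ⟨hb, hb'⟩
    refine ⟨?_, fun p => ?_⟩
    · rw [map_mul, Units.val_mul, Prod.fst_mul, ha, hb, one_mul]
    · rw [map_mul, Units.val_mul, Prod.snd_mul, Pi.mul_apply, norm_mul, ha' p, hb' p, one_mul]
  one_mem' := by
    refine ⟨?_, fun p => ?_⟩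
    · rw [map_one, Units.val_one, Prod.fst_one]
    · rw [map_one, Units.val_one, Prod.snd_one, Pi.one_apply, norm_one]
  inv_mem' := by
    rintro a ⟨ha, ha'⟩
    have h : (a.det : QS S) * ((a⁻¹).det : QS S) = 1 := by
      rw [← Units.val_mul, ← map_mul, mul_inv_cancel, map_one, Units.val_one]
    refine ⟨?_, fun p => ?_⟩
    · have h1 := congrArg Prod.fst h
      rwa [Prod.fst_mul, ha, one_mul, Prod.fst_one] at h1
    · have h2 := congrArg norm (congrFun (congrArg Prod.snd h) p)
      rwa [Prod.snd_mul, Pi.mul_apply, norm_mul, ha' p, one_mul, Prod.snd_one, Pi.one_apply,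
        norm_one] at h2

/-- `SL_d(ℚ_S) = ∏_{p ∈ S} SL_d(ℚ_p)`, as a subgroup of `GL_d(ℚ_S)`. -/
def SL (S : Finset Nat.Primes) (d : ℕ) : Subgroup (GLS S d) :=
  (Matrix.GeneralLinearGroup.det (n := Fin d) (R := QS S)).ker

/-- `GL_d(ℤ_S)`: the invertible matrices `g` such that `g` and `g⁻¹` have entries in `ℤ_S`. -/
def GLZS (S : Finset Nat.Primes) (d : ℕ) : Subgroup (GLS S d) where
  carrier := {g | (∀ i j, g.1 i j ∈ ZS S) ∧ ∀ i j, (g⁻¹).1 i j ∈ ZS S}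
  mul_mem' := by
    rintro a b ⟨ha, ha'⟩ ⟨hb, hb'⟩
    refine ⟨fun i j => ?_, fun i j => ?_⟩
    · rw [Units.val_mul, Matrix.mul_apply]
      exact sum_mem fun k _ => mul_mem (ha i k) (hb k j)
    · rw [mul_inv_rev, Units.val_mul, Matrix.mul_apply]
      exact sum_mem fun k _ => mul_mem (hb' i k) (ha' k j)
  one_mem' := by
    have h : ∀ i j, (1 : Matrix (Fin d) (Fin d) (QS S)) i j ∈ ZS S := by
      intro i j
      rw [Matrix.one_apply]
      split_ifs
      · exact one_mem _
      · exact zero_mem _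
    exact ⟨h, by rw [inv_one]; exact h⟩
  inv_mem' := by
    rintro a ⟨ha, ha'⟩
    exact ⟨ha', by rw [inv_inv]; exact ha⟩

/-- The arithmetic subgroup `Γ = G ∩ GL_d(ℤ_S)` of a subgroup `G` of `GL_d(ℚ_S)`. For
`G = UL_d(ℚ_S)` and `G = SL_d(ℚ_S)` it consists of all `g ∈ G` with entries in `ℤ_S`, see
`mem_Gam_UL` and `mem_Gam_SL`. -/
def Gam {S : Finset Nat.Primes} {d : ℕ} (G : Subgroup (GLS S d)) : Subgroup G :=
  (GLZS S d).subgroupOf G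

theorem SL_le_UL (S : Finset Nat.Primes) (d : ℕ) : SL S d ≤ UL S d := by
  intro g hg
  have h : g.det = 1 := hg
  refine ⟨?_, fun p => ?_⟩
  · rw [h, Units.val_one, Prod.fst_one]
  · rw [h, Units.val_one, Prod.snd_one, Pi.one_apply, norm_one]

theorem mem_Gam_of_le_UL {S : Finset Nat.Primes} {d : ℕ} {G : Subgroup (GLS S d)}
    (hG : G ≤ UL S d) (g : G) : g ∈ Gam G ↔ ∀ i j, g.1.1 i j ∈ ZS S := by
  refine ⟨fun h => h.1, fun h => ⟨h, ?_⟩⟩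
  have key : ∀ M : Matrix (Fin d) (Fin d) (QS S), (∀ i j, M i j ∈ ZS S) → M.det ∈ ZS S := by
    intro M hM
    rw [Matrix.det_apply]
    exact sum_mem fun σ _ => by
      rw [Units.smul_def]
      exact zsmul_mem (prod_mem fun i _ => hM _ _) _
  have hdet : (g.1.1).det = 1 := by
    obtain ⟨z, -, hz⟩ := key _ h
    have h1 : (g.1.1).det.1 = 1 := (hG g.2).1
    have hz1 : (z : ℝ) = 1 := by rw [← h1, ← hz]; rfl
    have : z = 1 := by exact_mod_cast hz1
    rw [← hz, this, map_one]
  have hinv : (g.1⁻¹).1 = (g.1.1).adjugate := by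
    have : (g.1⁻¹).1 = (g.1.1)⁻¹ := Matrix.coe_units_inv g.1
    rw [this, Matrix.inv_def, hdet, Ring.inverse_one, one_smul]
  intro i j
  change (g.1⁻¹).1 i j ∈ ZS S
  rw [hinv, Matrix.adjugate_apply]
  refine key _ fun k l => ?_
  rw [Matrix.updateRow_apply]
  split_ifs
  · rw [Pi.single_apply]
    split_ifs
    · exact one_mem _
    · exact zero_mem _
  · exact h k l

theorem mem_Gam_UL {S : Finset Nat.Primes} {d : ℕ} (g : UL S d) :
    g ∈ Gam (UL S d) ↔ ∀ i j, g.1.1 i j ∈ ZS S := mem_Gam_of_le_UL le_rfl g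

theorem mem_Gam_SL {S : Finset Nat.Primes} {d : ℕ} (g : SL S d) :
    g ∈ Gam (SL S d) ↔ ∀ i j, g.1.1 i j ∈ ZS S := mem_Gam_of_le_UL (SL_le_UL S d) g

/-- The `S`-lattice `g ℤ_S ^ d` in `ℚ_S ^ d`. -/
def latticeOf {S : Finset Nat.Primes} {d : ℕ} (g : GLS S d) : Set (Fin d → QS S) :=
  {v | ∃ x : Fin d → QS S, (∀ i, x i ∈ ZS S) ∧ v = g.1.mulVec x}

theorem latticeOf_mul_subset {S : Finset Nat.Primes} {d : ℕ} (g γ : GLS S d)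
    (hγ : γ ∈ GLZS S d) : latticeOf (g * γ) ⊆ latticeOf g := by
  rintro _ ⟨x, hx, rfl⟩
  refine ⟨γ.1.mulVec x, fun i => ?_, ?_⟩
  · rw [Matrix.mulVec_eq_sum, Finset.sum_apply]
    exact sum_mem fun k _ => mul_mem (hγ.1 i k) (hx k)
  · rw [Matrix.mulVec_mulVec, Units.val_mul]

/-- The `S`-lattice `g ℤ_S ^ d` attached to the coset `g Γ`. -/
def lattice {S : Finset Nat.Primes} {d : ℕ} {G : Subgroup (GLS S d)} :
    G ⧸ Gam G → Set (Fin d → QS S) :=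
  Quotient.lift (fun g : G => latticeOf g.1) (by
    intro a b hab
    have h : (a.1)⁻¹ * b.1 ∈ GLZS S d := 
      QuotientGroup.leftRel_apply (s := Gam G).mp hab
    apply Set.Subset.antisymm
    · have := latticeOf_mul_subset b.1 _ (inv_mem h)
      rwa [mul_inv_rev, inv_inv, mul_inv_cancel_left] at this
    · have := latticeOf_mul_subset a.1 _ h
      rwa [mul_inv_cancel_left] at this)

/-- The Siegel transform of a nonnegative function `f` on `ℚ_S ^ d`: the sum of `f` over the
nonzero vectors of a lattice, with values in `[0, ∞]`. -/
def siegel {S : Finset Nat.Primes} {d : ℕ} {G : Subgroup (GLS S d)}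
    (f : (Fin d → QS S) → ℝ≥0∞) (x : G ⧸ Gam G) : ℝ≥0∞ :=
  ∑' v : (lattice x \ {0} : Set (Fin d → QS S)), f v.1

end SArithmetic

end

/-!
Chebyshev's inequality bounds the probability that a random lattice misses `A` by
`Var / μ(A) ^ 2 ≤ C / μ(A)`, provided that the mean of the Siegel transform of `I_A` is at least
`μ(A)` (`measure_eq_zero_le_of_second_moment`). The work lies in this half of Siegel's mean value
formula, `mu_le_lintegral_siegel`. It is proved without reduction theory, so the argument never uses
that Siegel transforms are integrable.

Let `ν(A) = ∫ Ĩ_A dm` (`intensity`), possibly infinite. It is invariant under `G`, in particular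
under the shears `v ↦ v + t v_j e_i`. When `v_j` is a unit of `ℚ_S`, these translate the coordinate
`i` by arbitrary amounts. Together with Tonelli's theorem this makes the operation of integrating
out a coordinate self-adjoint with respect to `ν` (`IsShearInvariant.lintegral_mul_marginal`), and
integrating out all the coordinates one after the other gives `ν = c μ` with `c = ν(D)`, where
`D = ([0, 1) × ∏ ℤ_p) ^ d` has measure `1` (`IsShearInvariant.lintegral_eq`). Tonelli's theorem for
`ν` comes from the one for `m` because a lattice is countable. That `ν`-almost all vectors have unit
coordinates follows from shear invariance too (`IsShearInvariant.ae_map_ne_zero`).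

It remains to see that `c ≥ 1` (`one_le_intensity_unitBox`). As `D + ℤ_S ^ d = ℚ_S ^ d`, counting
lattice points in large boxes shows that `g ℤ_S ^ d` has lower density at least `1 / μ(g D)`
(`inv_mu_domain_le_liminf`), and by Fatou's lemma `c` is at least the mean of the lower density.
Hence `c > 0`. If `c` is finite, then `μ = ν / c` is `G`-invariant, therefore `μ(g D) = μ(D) = 1`
for all `g`, and the mean is at least `1`.
-/

/-! ### Measures on a power of a ring that are invariant under shears -/

section Shear

/-- The shear `v ↦ v + t v_j e_i` of `R ^ ι`, the action of an elementary matrix. -/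
def shear {R ι : Type*} [CommRing R] [DecidableEq ι] (i j : ι) (t : R) (v : ι → R) : ι → R :=
  Function.update v i (v i + t * v j)

theorem shear_shear_neg {R ι : Type*} [CommRing R] [DecidableEq ι] {i j : ι} (hij : i ≠ j) (t : R)
    (v : ι → R) : shear i j t (shear i j (-t) v) = v := by
  ext k
  by_cases hk : k = i
  · subst hk
    simp [shear, Function.update_of_ne hij.symm]
  · simp [shear, Function.update_of_ne hk]

theorem measurable_shear_uncurry {R ι : Type*} [CommRing R] [TopologicalSpace R]
    [IsTopologicalRing R] [SecondCountableTopology R] [MeasurableSpace R] [BorelSpace R]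
    [DecidableEq ι] (i j : ι) :
    Measurable fun p : R × (ι → R) => shear i j p.1 p.2 := by
  refine measurable_pi_iff.2 fun k => ?_
  by_cases hk : k = i
  · subst hk
    simp only [shear, Function.update_self]
    fun_prop
  · simp only [shear, Function.update_of_ne hk]
    fun_prop

/-- A measure on `R ^ ι` that is invariant under shears and satisfies Tonelli's theorem together
with the measure `lam` on `R`. The second condition takes the place of s-finiteness. -/
structure IsShearInvariant {R ι : Type*} [CommRing R] [MeasurableSpace R] [DecidableEq ι]
    (lam : Measure R) (nu : Measure (ι → R)) : Prop where
  lintegral_shear : ∀ i j, i ≠ j → ∀ t, ∀ f : (ι → R) → ℝ≥0∞, Measurable f →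
    ∫⁻ v, f (shear i j t v) ∂nu = ∫⁻ v, f v ∂nu
  tonelli : ∀ Φ : R × (ι → R) → ℝ≥0∞, Measurable Φ →
    ∫⁻ t, ∫⁻ v, Φ (t, v) ∂nu ∂lam = ∫⁻ v, ∫⁻ t, Φ (t, v) ∂lam ∂nu

variable {R ι : Type*} [CommRing R] [TopologicalSpace R] [IsTopologicalRing R]
  [LocallyCompactSpace R] [SecondCountableTopology R] [MeasurableSpace R] [BorelSpace R]

/-- Multiplication by a unit scales Haar measure. The factor is evaluated on the set `U`, which
makes it a measurable function of the multiplier. -/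
theorem lintegral_add_mul_unit (lam : Measure R) [lam.IsAddHaarMeasure]
    {U : Set R} (hU : MeasurableSet U) (hU1 : lam U = 1) {q : R} (hq : IsUnit q) :
    lam ((· * q) ⁻¹' U) ≠ 0 ∧ lam ((· * q) ⁻¹' U) ≠ ∞ ∧
    ∀ F : R → ℝ≥0∞, Measurable F → ∀ s,
      ∫⁻ t, F (s + t * q) ∂lam = lam ((· * q) ⁻¹' U) * ∫⁻ t, F t ∂lam := by
  obtain ⟨u, rfl⟩ := hq
  let e : R ≃+ R := AddEquiv.mk' u.mulRight fun x y => by simp [add_mul]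
  have hec : Continuous e := continuous_id.mul continuous_const
  have hec' : Continuous e.symm := continuous_id.mul continuous_const
  have hH : (lam.map e).IsAddHaarMeasure := e.isAddHaarMeasure_map lam hec hec'
  have hm := Measure.isAddLeftInvariant_eq_smul (lam.map e) lam
  set a := (lam.map e).addHaarScalarFactor lam
  have ha : lam ((· * (u : R)) ⁻¹' U) = a := by
    have h1 : lam.map e U = lam ((· * (u : R)) ⁻¹' U) := Measure.map_apply hec.measurable hU
    rw [← h1, hm, Measure.smul_apply, hU1]
    simp [ENNReal.smul_def]
  have ha0 : a ≠ 0 := (Measure.addHaarScalarFactor_pos_of_isAddHaarMeasure _ _).ne'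
  rw [ha]
  refine ⟨by simpa using ha0, ENNReal.coe_ne_top, fun F hF s => ?_⟩
  have h2 : ∫⁻ t, F (s + t * u) ∂lam = ∫⁻ t, F (s + t) ∂(lam.map e) := by
    have hFs : Measurable fun t => F (s + t) := hF.comp (measurable_const_add s)
    rw [lintegral_map hFs hec.measurable]
    rfl
  rw [h2, hm, lintegral_smul_measure, lintegral_add_left_eq_self (μ := lam) F s]
  simp [ENNReal.smul_def]

variable [DecidableEq ι]

open Function in
/-- The key symmetry: integrating out the coordinate `i` is self-adjoint for a shear-invariant
measure. The reason is that on vectors with `v_j` a unit, the shears `v ↦ v + t v_j e_i` translate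
the coordinate `i` by arbitrary amounts. -/
theorem IsShearInvariant.lintegral_mul_marginal {lam : Measure R} [lam.IsAddHaarMeasure]
    {nu : Measure (ι → R)} (h : IsShearInvariant lam nu)
    (hunit : ∀ j, ∀ᵐ v ∂nu, IsUnit (v j))
    {U : Set R} (hU : MeasurableSet U) (hU1 : lam U = 1)
    {i j : ι} (hij : i ≠ j) {f g : (ι → R) → ℝ≥0∞} (hf : Measurable f) (hg : Measurable g) :
    ∫⁻ v, g v * ∫⁻ s, f (update v i s) ∂lam ∂nu = ∫⁻ v, f v * ∫⁻ s, g (update v i s) ∂lam ∂nu := by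
  let κ : R → ℝ≥0∞ := fun q => lam ((· * q) ⁻¹' U)
  have hκ : Measurable κ := by
    have : MeasurableSet ((fun p : R × R => p.2 * p.1) ⁻¹' U) :=
      (measurable_snd.mul measurable_fst) hU
    exact measurable_measure_prodMk_left this
  -- the integral over the coordinate `i` as an average over the shears
  have key : ∀ F : (ι → R) → ℝ≥0∞, Measurable F → ∀ v, IsUnit (v j) →
      ∫⁻ s, F (update v i s) ∂lam = (κ (v j))⁻¹ * ∫⁻ t, F (shear i j t v) ∂lam := by
    intro F hF v hv
    obtain ⟨h0, h1, h2⟩ := lintegral_add_mul_unit lam hU hU1 hv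
    have := h2 (fun s => F (update v i s)) (hF.comp (measurable_update v)) (v i)
    change _ = (κ (v j))⁻¹ * ∫⁻ t, F (update v i (v i + t * v j)) ∂lam
    rw [this, ← mul_assoc, ENNReal.inv_mul_cancel h0 h1, one_mul]
  have hS := measurable_shear_uncurry (R := R) i j
  have hSt : ∀ t : R, Measurable (shear i j t : (ι → R) → (ι → R)) := fun t =>
    hS.comp measurable_prodMk_left
  have hκj : Measurable fun v : ι → R => (κ (v j))⁻¹ := (hκ.comp (measurable_pi_apply j)).inv
  calc ∫⁻ v, g v * ∫⁻ s, f (update v i s) ∂lam ∂nu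
      = ∫⁻ v, ∫⁻ t, g v * (κ (v j))⁻¹ * f (shear i j t v) ∂lam ∂nu := by
        refine lintegral_congr_ae ((hunit j).mono fun v hv => ?_)
        simp only
        rw [key f hf v hv, ← mul_assoc, lintegral_const_mul]
        exact hf.comp (hS.comp measurable_prodMk_right)
    _ = ∫⁻ t, ∫⁻ v, g v * (κ (v j))⁻¹ * f (shear i j t v) ∂nu ∂lam := by
        refine (h.tonelli (fun p => g p.2 * (κ (p.2 j))⁻¹ * f (shear i j p.1 p.2)) ?_).symm
        exact ((hg.comp measurable_snd).mul (hκj.comp measurable_snd)).mul (hf.comp hS)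
    _ = ∫⁻ t, ∫⁻ v, g (shear i j (-t) v) * (κ (v j))⁻¹ * f v ∂nu ∂lam := by
        refine lintegral_congr fun t => ?_
        rw [← h.lintegral_shear i j hij (-t) (fun v => g v * (κ (v j))⁻¹ * f (shear i j t v))
          ((hg.mul hκj).mul (hf.comp (hSt t)))]
        refine lintegral_congr fun v => ?_
        simp only [shear_shear_neg hij]
        simp [shear, Function.update_of_ne hij.symm]
    _ = ∫⁻ t, ∫⁻ v, g (shear i j t v) * (κ (v j))⁻¹ * f v ∂nu ∂lam :=
        lintegral_neg_eq_self
          (fun t => ∫⁻ v, g (shear i j t v) * (κ (v j))⁻¹ * f v ∂nu)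
    _ = ∫⁻ v, ∫⁻ t, g (shear i j t v) * (κ (v j))⁻¹ * f v ∂lam ∂nu := by
        refine h.tonelli (fun p => g (shear i j p.1 p.2) * (κ (p.2 j))⁻¹ * f p.2) ?_
        exact ((hg.comp hS).mul (hκj.comp measurable_snd)).mul (hf.comp measurable_snd)
    _ = ∫⁻ v, f v * ∫⁻ s, g (update v i s) ∂lam ∂nu := by
        refine lintegral_congr_ae ((hunit j).mono fun v hv => ?_)
        simp only
        rw [key g hg v hv, ← mul_assoc, ← lintegral_const_mul]
        · exact lintegral_congr fun t => by ring
        · exact hg.comp (hS.comp measurable_prodMk_right)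

end Shear

section ShearUnique

variable {R ι : Type*} [CommRing R] [TopologicalSpace R] [IsTopologicalRing R]
  [SecondCountableTopology R] [MeasurableSpace R] [BorelSpace R] [DecidableEq ι] [Fintype ι]

/-- A shear-invariant measure is a multiple, possibly infinite, of the product of Haar measures. -/
theorem IsShearInvariant.lintegral_eq [LocallyCompactSpace R] [Nontrivial ι] {lam : Measure R}
    [lam.IsAddHaarMeasure]
    {nu : Measure (ι → R)} (h : IsShearInvariant lam nu)
    (hunit : ∀ j, ∀ᵐ v ∂nu, IsUnit (v j))
    {U : Set R} (hU : MeasurableSet U) (hU1 : lam U = 1)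
    {f : (ι → R) → ℝ≥0∞} (hf : Measurable f) :
    ∫⁻ v, f v ∂nu = nu (Set.univ.pi fun _ => U) * ∫⁻ v, f v ∂(Measure.pi fun _ => lam) := by
  let χ : R → ℝ≥0∞ := U.indicator 1
  have hχ : Measurable χ := measurable_one.indicator hU
  have hχ1 : ∫⁻ s, χ s ∂lam = 1 := by rw [lintegral_indicator_one hU, hU1]
  have hprod : ∀ s : Finset ι, Measurable fun v : ι → R => ∏ k ∈ s, χ (v k) := fun s =>
    Finset.measurable_fun_prod s fun k _ => hχ.comp (measurable_pi_apply k)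
  -- the coordinates in `s` are integrated out one at a time
  have key : ∀ s : Finset ι, ∫⁻ v, f v ∂nu =
      ∫⁻ v, (∏ k ∈ s, χ (v k)) * (∫⋯∫⁻_s, f ∂fun _ => lam) v ∂nu := by
    intro s
    induction s using Finset.induction_on with
    | empty => simp
    | insert i s hi ih =>
      obtain ⟨j, hj⟩ := exists_ne i
      have hm : Measurable (∫⋯∫⁻_s, f ∂fun _ => lam) := hf.lmarginal _
      have := h.lintegral_mul_marginal hunit hU hU1 hj.symm
        (f := fun v => (∏ k ∈ s, χ (v k)) * (∫⋯∫⁻_s, f ∂fun _ => lam) v) (g := fun v => χ (v i))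
        ((hprod s).mul hm) (hχ.comp (measurable_pi_apply i))
      simp only [Function.update_self, hχ1, mul_one] at this
      rw [ih, ← this]
      refine lintegral_congr fun v => ?_
      have hmu : Measurable fun t => (∫⋯∫⁻_s, f ∂fun _ => lam) (Function.update v i t) :=
        hm.comp (measurable_update v)
      rw [lmarginal_insert f hf hi, Finset.prod_insert hi, mul_assoc, ← lintegral_const_mul _ hmu]
      congr 1
      refine lintegral_congr fun t => ?_
      congr 1
      refine Finset.prod_congr rfl fun k hk => ?_
      rw [Function.update_of_ne (ne_of_mem_of_not_mem hk hi)]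
  have hpi : ∀ v : ι → R, ∏ k, χ (v k) = (Set.univ.pi fun _ => U).indicator 1 v := by
    intro v
    by_cases hv : v ∈ Set.univ.pi fun _ => U
    · rw [Set.indicator_of_mem hv]
      exact Finset.prod_eq_one fun k _ => Set.indicator_of_mem (hv k trivial) _
    · rw [Set.indicator_of_notMem hv]
      simp only [Set.mem_pi, Set.mem_univ, true_imp_iff, not_forall] at hv
      obtain ⟨k, hk⟩ := hv
      exact Finset.prod_eq_zero (Finset.mem_univ k) (Set.indicator_of_notMem hk _)
  rw [key Finset.univ]
  simp only [lmarginal_univ]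
  rw [lintegral_mul_const _ (hprod _)]
  simp only [hpi]
  rw [lintegral_indicator_one (MeasurableSet.univ_pi fun _ => hU)]

/-- Let `φ` be a homomorphism to a field with null fibres. If almost every vector has a coordinate
with nonzero image under `φ`, then almost every vector has all its coordinates like this:
coordinates are dropped from the first condition one by one, since adding a generic multiple of a
dropped coordinate `v_j` to `v_i` makes `φ (v_i)` nonzero. -/
theorem IsShearInvariant.ae_map_ne_zero {K : Type*} [Field K] [MeasurableSpace K]
    [MeasurableSingletonClass K] {lam : Measure R} [lam.IsAddHaarMeasure]
    {nu : Measure (ι → R)} (h : IsShearInvariant lam nu) (φ : R →+* K) (hφ : Measurable φ)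
    (hnull : ∀ b, lam (φ ⁻¹' {b}) = 0) (hne : ∀ᵐ v ∂nu, ∃ k, φ (v k) ≠ 0) (i : ι) :
    ∀ᵐ v ∂nu, φ (v i) ≠ 0 := by
  have hmeas : ∀ J : Finset ι, MeasurableSet {v : ι → R | ∀ k ∈ J, φ (v k) = 0} := by
    intro J
    have : {v : ι → R | ∀ k ∈ J, φ (v k) = 0} = ⋂ k ∈ J, (fun v => φ (v k)) ⁻¹' {0} := by
      ext; simp
    rw [this]
    exact J.measurableSet_biInter fun k _ =>
      (hφ.comp (measurable_pi_apply k)) (measurableSet_singleton 0)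
  have key : ∀ T : Finset ι, i ∉ T → nu {v | ∀ k ∈ Tᶜ, φ (v k) = 0} = 0 := by
    intro T
    induction T using Finset.induction_on with
    | empty =>
      intro _
      rw [ae_iff] at hne
      simpa using hne
    | insert j T hj ih =>
      intro hi
      have hij : i ≠ j := fun e => hi (by simp [e])
      have hiT : i ∉ T := fun e => hi (Finset.mem_insert_of_mem e)
      set B := {v : ι → R | ∀ k ∈ (insert j T)ᶜ, φ (v k) = 0}
      have hB : MeasurableSet B := hmeas _
      have hBi : Measurable (B.indicator (1 : (ι → R) → ℝ≥0∞)) := measurable_one.indicator hB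
      have hS := measurable_shear_uncurry (R := R) i j
      have h1 := h.tonelli (fun p => B.indicator 1 (shear i j p.1 p.2)) (hBi.comp hS)
      have h2 : ∀ t, ∫⁻ v, B.indicator (1 : (ι → R) → ℝ≥0∞) (shear i j t v) ∂nu = nu B := by
        intro t
        rw [h.lintegral_shear i j hij t _ hBi, lintegral_indicator_one hB]
      have h3 : ∫⁻ v, ∫⁻ t, B.indicator (1 : (ι → R) → ℝ≥0∞) (shear i j t v) ∂lam ∂nu = 0 := by
        have hgood : ∀ᵐ v ∂nu, ¬ ∀ k ∈ Tᶜ, φ (v k) = 0 := by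
          rw [ae_iff]; simpa using ih hiT
        rw [← lintegral_zero (μ := nu)]
        refine lintegral_congr_ae (hgood.mono fun v hv => ?_)
        have hmt : MeasurableSet ((fun t => shear i j t v) ⁻¹' B) :=
          (hS.comp measurable_prodMk_right) hB
        have : ∫⁻ t, B.indicator (1 : (ι → R) → ℝ≥0∞) (shear i j t v) ∂lam
            = lam ((fun t => shear i j t v) ⁻¹' B) := by
          rw [← lintegral_indicator_one hmt]; rfl
        simp only [this]
        -- the bad parameters solve a nontrivial linear equation
        refine measure_mono_null (t := φ ⁻¹' {-(φ (v i)) / φ (v j)}) (fun t ht => ?_) (hnull _)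
        have ht : ∀ k ∈ (insert j T)ᶜ, φ (shear i j t v k) = 0 := ht
        have hti : φ (v i) + φ t * φ (v j) = 0 := by
          simpa [shear] using ht i (by simpa using ⟨hij, hiT⟩)
        have hvj : φ (v j) ≠ 0 := by
          intro h0
          refine hv fun k hk => ?_
          by_cases hki : k = i
          · rw [hki]; simpa [h0] using hti
          by_cases hkj : k = j
          · rw [hkj, h0]
          have := ht k (by simpa using ⟨hkj, by simpa using hk⟩)
          rwa [shear, Function.update_of_ne hki] at this
        rw [Set.mem_preimage, Set.mem_singleton_iff, eq_div_iff hvj]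
        linear_combination hti
      simp only [h2, h3, lintegral_const, mul_eq_zero] at h1
      exact h1.resolve_right (NeZero.ne _)
  have := key {i}ᶜ (by simp)
  rw [ae_iff]
  simpa using this

end ShearUnique

namespace SArithmetic

/-! ### Topology and measures on `ℚ_S` and its groups -/

variable {S : Finset Nat.Primes} {d : ℕ}

instance padicHaar_isAddHaarMeasure (p : ℕ) [Fact p.Prime] : (padicHaar p).IsAddHaarMeasure := by
  unfold padicHaar; infer_instance

instance muQS_isAddHaarMeasure : (muQS S).IsAddHaarMeasure := by
  unfold muQS; infer_instance

instance muQS_sigmaFinite : SigmaFinite (muQS S) := by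
  unfold muQS; infer_instance

instance mu_isAddHaarMeasure : (mu S d).IsAddHaarMeasure := by
  unfold mu; infer_instance

theorem padicHaar_closedBall_one (p : ℕ) [Fact p.Prime] :
    padicHaar p (Metric.closedBall 0 1) = 1 :=
  Measure.addHaarMeasure_self (K₀ := padicUnitBall p)

/-- `[0, 1) × ∏ ℤ_p`, a fundamental domain of `ℤ_S` in `ℚ_S`. -/
def unitBox (S : Finset Nat.Primes) : Set (QS S) :=
  Set.Ico 0 1 ×ˢ Set.univ.pi fun _ => Metric.closedBall 0 1

theorem measurableSet_unitBox : MeasurableSet (unitBox S) :=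
  measurableSet_Ico.prod (MeasurableSet.univ_pi fun _ => measurableSet_closedBall)

theorem muQS_unitBox : muQS S (unitBox S) = 1 := by
  simp [muQS, unitBox, Measure.prod_prod, Measure.pi_pi, padicHaar_closedBall_one]

theorem isUnit_iff (q : QS S) : IsUnit q ↔ q.1 ≠ 0 ∧ ∀ p, q.2 p ≠ 0 := by
  rw [Prod.isUnit_iff, Pi.isUnit_iff]
  simp [isUnit_iff_ne_zero]

theorem muQS_fst_fiber (b : ℝ) : muQS S (RingHom.fst ℝ (∀ p : S, ℚ_[(p.1 : ℕ)]) ⁻¹' {b}) = 0 := by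
  have : RingHom.fst ℝ (∀ p : S, ℚ_[(p.1 : ℕ)]) ⁻¹' {b} = {b} ×ˢ Set.univ := by
    ext; simp
  rw [this, muQS, Measure.prod_prod]
  simp

theorem muQS_snd_fiber (p : S) (b : ℚ_[(p.1 : ℕ)]) :
    muQS S ((Pi.evalRingHom (fun p : S => ℚ_[(p.1 : ℕ)]) p).comp (RingHom.snd ℝ _) ⁻¹' {b}) =
      0 := by
  have : (Pi.evalRingHom (fun p : S => ℚ_[(p.1 : ℕ)]) p).comp (RingHom.snd ℝ _) ⁻¹' {b}
      = Set.univ ×ˢ ((fun q : ∀ p : S, ℚ_[(p.1 : ℕ)] => q p) ⁻¹' {b}) := by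
    ext; simp
  have h0 : Measure.pi (fun p : S => padicHaar (p.1 : ℕ))
      ((fun q : ∀ p : S, ℚ_[(p.1 : ℕ)] => q p) ⁻¹' {b}) = 0 :=
    Measure.pi_eval_preimage_null _ (measure_singleton b)
  rw [this, muQS, Measure.prod_prod, h0, mul_zero]

theorem continuous_GL_apply (i j : Fin d) : Continuous fun g : GLS S d => g.1 i j :=
  (continuous_id.matrix_elem i j).comp Units.continuous_val

set_option synthInstance.maxSize 1000 in
instance GLS_polishSpace : PolishSpace (GLS S d) := by
  have : PolishSpace (Matrix (Fin d) (Fin d) (QS S)) :=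
    inferInstanceAs (PolishSpace (Fin d → Fin d → QS S))
  have : PolishSpace (Matrix (Fin d) (Fin d) (QS S))ᵐᵒᵖ :=
    MulOpposite.opHomeomorph.symm.isClosedEmbedding.polishSpace
  exact Units.isClosedEmbedding_embedProduct.polishSpace

theorem continuous_det : Continuous fun g : GLS S d => (g.det : QS S) :=
  Continuous.matrix_det Units.continuous_val

theorem isClosed_UL : IsClosed (UL S d : Set (GLS S d)) := by
  have : (UL S d : Set (GLS S d)) =
      {g | (g.det : QS S).1 = 1} ∩ ⋂ p, {g | ‖(g.det : QS S).2 p‖ = 1} := by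
    ext g; simp [UL]
  rw [this]
  refine IsClosed.inter (isClosed_eq (continuous_fst.comp continuous_det) continuous_const)
    (isClosed_iInter fun p => isClosed_eq ?_ continuous_const)
  exact (((continuous_apply p).comp continuous_snd).comp continuous_det).norm

theorem isClosed_SL : IsClosed (SL S d : Set (GLS S d)) := by
  have : (SL S d : Set (GLS S d)) = {g | (g.det : QS S) = 1} := by
    ext g
    simp only [SL, SetLike.mem_coe, MonoidHom.mem_ker, Set.mem_ofPred_eq, Units.ext_iff,
      Units.val_one]
  rw [this]
  exact isClosed_eq continuous_det continuous_const

/-! ### `ℤ_S` is a discrete subgroup of `ℚ_S` with bounded fundamental domain -/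

theorem norm_ratCast_le_one_iff {p : ℕ} [Fact p.Prime] {z : ℚ} :
    ‖(z : ℚ_[p])‖ ≤ 1 ↔ ¬ p ∣ z.den := by
  rw [Padic.norm_rat_le_one_iff_padicValuation_le_one, Rat.padicValuation_le_one_iff]

theorem exists_int_of_forall_norm_le_one {z : ℚ}
    (h : ∀ p : Nat.Primes, ‖(z : ℚ_[(p : ℕ)])‖ ≤ 1) : ∃ n : ℤ, z = n := by
  have : z.den = 1 := by
    by_contra hne
    obtain ⟨p, hp, hpd⟩ := Nat.exists_prime_and_dvd hne
    have := Fact.mk hp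
    exact norm_ratCast_le_one_iff.1 (h ⟨p, hp⟩) hpd
  exact ⟨z.num, (Rat.coe_int_num_of_den_eq_one this).symm⟩

theorem eq_zero_of_mem_ratSIntegers {z : ℚ} (hz : z ∈ ratSIntegers S)
    (h1 : |(z : ℝ)| < 1) (h2 : ∀ p ∈ S, ‖(z : ℚ_[(p : ℕ)])‖ ≤ 1) : z = 0 := by
  obtain ⟨n, rfl⟩ := exists_int_of_forall_norm_le_one (z := z) fun p =>
    if hp : p ∈ S then h2 p hp else hz p hp
  have : |n| < 1 := by exact_mod_cast h1
  simpa using Int.abs_lt_one_iff.1 this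

theorem isClosed_ZS : IsClosed (ZS S : Set (QS S)) := by
  have hd : DiscreteTopology (ZS S).toAddSubgroup := by
    refine discreteTopology_of_isOpen_singleton_zero ?_
    have : ({0} : Set (ZS S).toAddSubgroup) = Subtype.val ⁻¹' Metric.ball (0 : QS S) 1 := by
      ext ⟨x, z, hz, hzx⟩
      rw [Set.mem_singleton_iff, Set.mem_preimage, mem_ball_zero_iff, Subtype.ext_iff]
      refine ⟨fun h => by rw [h]; simp, fun h => ?_⟩
      change ‖x‖ < 1 at h
      change x = 0
      rw [Prod.norm_def, max_lt_iff, pi_norm_lt_iff one_pos] at h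
      subst hzx
      have : z = 0 := eq_zero_of_mem_ratSIntegers hz h.1 fun p hp => (h.2 ⟨p, hp⟩).le
      rw [this]
      exact map_zero _
    rw [this]
    exact Metric.isOpen_ball.preimage continuous_subtype_val
  exact AddSubgroup.isClosed_of_discrete (H := (ZS S).toAddSubgroup)

theorem isClosed_GLZS : IsClosed (GLZS S d : Set (GLS S d)) := by
  have : (GLZS S d : Set (GLS S d)) =
      (⋂ i, ⋂ j, {g | g.1 i j ∈ ZS S}) ∩ ⋂ i, ⋂ j, {g | (g⁻¹).1 i j ∈ ZS S} := by
    ext g; simp [GLZS]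
  rw [this]
  exact (isClosed_iInter fun i => isClosed_iInter fun j =>
      isClosed_ZS.preimage (continuous_GL_apply i j)).inter
    (isClosed_iInter fun i => isClosed_iInter fun j =>
      isClosed_ZS.preimage ((continuous_GL_apply i j).comp continuous_inv))

theorem isClosed_Gam (G : Subgroup (GLS S d)) : IsClosed (Gam G : Set G) :=
  isClosed_GLZS.preimage continuous_subtype_val

/-- Approximation of a `p`-adic number up to `ℤ_p` by a rational number with no other prime in its
denominator. -/
theorem exists_rat_approx (p : Nat.Primes) (x : ℚ_[(p : ℕ)]) :
    ∃ z : ℚ, ‖x - z‖ ≤ 1 ∧ ∀ q : Nat.Primes, q ≠ p → ‖(z : ℚ_[(q : ℕ)])‖ ≤ 1 := by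
  have hp0 : (0 : ℝ) < (p : ℕ) := by exact_mod_cast p.2.pos
  obtain ⟨k, hk⟩ := pow_unbounded_of_one_lt ‖x‖ (by exact_mod_cast p.2.one_lt : (1 : ℝ) < (p : ℕ))
  have hy : ‖x * ((p : ℕ) : ℚ_[(p : ℕ)]) ^ k‖ ≤ 1 := by
    rw [norm_mul, norm_pow, Padic.norm_p, inv_pow, ← div_eq_mul_inv, div_le_one (by positivity)]
    exact hk.le
  let y : ℤ_[(p : ℕ)] := ⟨_, hy⟩
  have happ := (PadicInt.norm_le_pow_iff_mem_span_pow _ k).2 (PadicInt.appr_spec k y)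
  have hpk : ((p : ℕ) : ℚ_[(p : ℕ)]) ^ k ≠ 0 := pow_ne_zero _ (by exact_mod_cast p.2.ne_zero)
  refine ⟨(y.appr k : ℚ) / (p : ℕ) ^ k, ?_, fun q hq => ?_⟩
  · have h1 : ‖x * ((p : ℕ) : ℚ_[(p : ℕ)]) ^ k - (y.appr k : ℚ_[(p : ℕ)])‖ ≤
        ((p : ℕ) : ℝ) ^ (-k : ℤ) := by
      rwa [PadicInt.norm_def, PadicInt.coe_sub, PadicInt.coe_natCast] at happ
    have h2 : x - (((y.appr k : ℚ) / (p : ℕ) ^ k : ℚ) : ℚ_[(p : ℕ)]) =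
        (x * ((p : ℕ) : ℚ_[(p : ℕ)]) ^ k - (y.appr k : ℚ_[(p : ℕ)])) /
          ((p : ℕ) : ℚ_[(p : ℕ)]) ^ k := by
      push_cast
      field_simp
    rw [h2, norm_div, norm_pow, Padic.norm_p, div_le_one (by positivity)]
    simpa using h1
  · have h1 : ‖((p : ℕ) : ℚ_[(q : ℕ)])‖ = 1 := by
      have := (Nat.coprime_primes p.2 q.2).2 fun e => hq (Subtype.ext e.symm)
      rw [Padic.norm_natCast_eq_one_iff]
      exact this.symm
    push_cast
    rw [norm_div, norm_pow, h1, one_pow, div_one]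
    exact_mod_cast Padic.norm_int_le_one (p := (q : ℕ)) (y.appr k : ℤ)

/-- The translates of the box `[0, 1) × ∏ ℤ_p` by `ℤ_S` cover `ℚ_S`. -/
theorem exists_sub_mem_unitBox (x : QS S) : ∃ z ∈ ZS S, x - z ∈ unitBox S := by
  classical
  choose w hw1 hw2 using fun p : S => exists_rat_approx p.1 (x.2 p)
  let n : ℤ := ⌊x.1 - ((∑ p, w p : ℚ) : ℝ)⌋
  have hsum : ∀ (q : Nat.Primes) (T : Finset S), (∀ p ∈ T, p.1 ≠ q) →
      ‖((∑ p ∈ T, w p : ℚ) : ℚ_[(q : ℕ)])‖ ≤ 1 := by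
    intro q T hT
    push_cast
    exact IsUltrametricDist.norm_sum_le_of_forall_le_of_nonneg zero_le_one fun p hp =>
      hw2 p q (hT p hp).symm
  have hn : ∀ q : Nat.Primes, ‖((n : ℚ) : ℚ_[(q : ℕ)])‖ ≤ 1 := fun q => by
    exact_mod_cast Padic.norm_int_le_one (p := (q : ℕ)) n
  refine ⟨diagEmb S (∑ p, w p + n), ⟨_, fun q hq => ?_, rfl⟩, ?_, fun p _ => ?_⟩
  · rw [Rat.cast_add]
    exact (Padic.nonarchimedean _ _).trans (max_le
      (hsum q _ fun p _ e => hq (e ▸ p.2)) (hn q))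
  · have h1 : (x - diagEmb S (∑ p, w p + n)).1 = Int.fract (x.1 - ((∑ p, w p : ℚ) : ℝ)) := by
      change x.1 - ((∑ p, w p + n : ℚ) : ℝ) = _
      rw [Int.fract, Rat.cast_add, Rat.cast_intCast]
      ring
    rw [h1]
    exact ⟨Int.fract_nonneg _, Int.fract_lt_one _⟩
  · rw [mem_closedBall_zero_iff]
    have h1 : (x - diagEmb S (∑ p, w p + n)).2 p = (x.2 p - (w p : ℚ_[(p.1 : ℕ)])) +
        -(((∑ q ∈ Finset.univ.erase p, w q : ℚ) : ℚ_[(p.1 : ℕ)]) + ((n : ℚ) : ℚ_[(p.1 : ℕ)])) := by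
      change x.2 p - ((∑ p, w p + n : ℚ) : ℚ_[(p.1 : ℕ)]) = _
      rw [← Finset.add_sum_erase _ _ (Finset.mem_univ p), Rat.cast_add, Rat.cast_add]
      ring
    rw [h1]
    refine (Padic.nonarchimedean _ _).trans (max_le (hw1 p) ?_)
    rw [norm_neg]
    exact (Padic.nonarchimedean _ _).trans (max_le
      (hsum p.1 _ fun q hq e => Finset.ne_of_mem_erase hq (Subtype.ext e)) (hn p.1))

/-! ### The intensity measure of the random lattice -/

/-- The lattice vector `g z` with coordinates `z` in `ℤ_S ^ d`. -/
noncomputable def latVec (g : GLS S d) (z : Fin d → ratSIntegers S) : Fin d → QS S :=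
  g.1.mulVec fun i => diagEmb S (z i)

theorem GLS_mulVec_injective (g : GLS S d) : Function.Injective g.1.mulVec :=
  Matrix.mulVec_injective_of_isUnit g.isUnit

theorem latVec_injective (g : GLS S d) : Function.Injective (latVec g) := by
  intro z w h
  have h1 := GLS_mulVec_injective g h
  funext i
  exact Subtype.ext ((diagEmb S).injective (congrFun h1 i))

theorem latVec_zero (g : GLS S d) : latVec g 0 = 0 := by
  have : (fun i => diagEmb S ((0 : Fin d → ratSIntegers S) i)) = 0 := by
    funext i; simp
  rw [latVec, this, Matrix.mulVec_zero]

theorem latVec_mul (g h : GLS S d) (z : Fin d → ratSIntegers S) :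
    latVec (g * h) z = g.1.mulVec (latVec h z) := by
  rw [latVec, latVec, Matrix.mulVec_mulVec, Units.val_mul]

theorem latticeOf_eq_range (g : GLS S d) : latticeOf g = Set.range (latVec g) := by
  ext v
  constructor
  · rintro ⟨x, hx, rfl⟩
    choose z hz hzx using hx
    exact ⟨fun i => ⟨z i, hz i⟩, congrArg g.1.mulVec (funext hzx)⟩
  · rintro ⟨z, rfl⟩
    exact ⟨_, fun i => ⟨z i, (z i).2, rfl⟩, rfl⟩

theorem continuous_latVec (z : Fin d → ratSIntegers S) :
    Continuous fun g : GLS S d => latVec g z :=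
  Continuous.matrix_mulVec Units.continuous_val continuous_const

variable {G : Subgroup (GLS S d)}

theorem siegel_mk (f : (Fin d → QS S) → ℝ≥0∞) (g : G) :
    siegel f (QuotientGroup.mk g : G ⧸ Gam G) =
      ∑' z : {z : Fin d → ratSIntegers S // z ≠ 0}, f (latVec g.1 z) := by
  have h : lattice (QuotientGroup.mk g : G ⧸ Gam G) \ {0} =
      Set.range fun z : {z : Fin d → ratSIntegers S // z ≠ 0} => latVec g.1 z := by
    change latticeOf g.1 \ {0} = _
    rw [latticeOf_eq_range]
    ext v
    constructor
    · rintro ⟨⟨z, rfl⟩, hv⟩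
      exact ⟨⟨z, fun h0 => hv (by rw [h0]; exact latVec_zero _)⟩, rfl⟩
    · rintro ⟨z, rfl⟩
      exact ⟨⟨z.1, rfl⟩, fun h0 => z.2 (latVec_injective g.1 (h0.trans (latVec_zero _).symm))⟩
  rw [siegel, tsum_congr_set_coe f h]
  exact tsum_range f ((latVec_injective g.1).comp Subtype.val_injective)

theorem siegel_smul (f : (Fin d → QS S) → ℝ≥0∞) (g : G) (x : G ⧸ Gam G) :
    siegel f (g • x) = siegel (fun v => f (g.1.1.mulVec v)) x := by
  obtain ⟨h, rfl⟩ := QuotientGroup.mk_surjective x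
  have : g • (QuotientGroup.mk h : G ⧸ Gam G) = QuotientGroup.mk (g * h) := rfl
  rw [this, siegel_mk, siegel_mk]
  simp only [Subgroup.coe_mul, latVec_mul]

theorem siegel_mono {f g : (Fin d → QS S) → ℝ≥0∞} (h : f ≤ g) (x : G ⧸ Gam G) :
    siegel f x ≤ siegel g x :=
  ENNReal.tsum_le_tsum fun v => h v.1

/-- Measurability of Siegel transforms with a parameter. It is checked on `T × G`, where the
transform is a countable sum, and descends along the continuous surjection to `T × G ⧸ Γ` because
`T × G` is Polish. -/
theorem measurable_siegel_param (hG : IsClosed (G : Set (GLS S d)))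
    [MeasurableSpace (G ⧸ Gam G)] [BorelSpace (G ⧸ Gam G)]
    {T : Type*} [TopologicalSpace T] [PolishSpace T] [MeasurableSpace T] [BorelSpace T]
    {Φ : T × (Fin d → QS S) → ℝ≥0∞} (hΦ : Measurable Φ) :
    Measurable fun p : T × (G ⧸ Gam G) => siegel (fun v => Φ (p.1, v)) p.2 := by
  have : PolishSpace G := hG.polishSpace
  have : IsClosed (Gam G : Set G) := isClosed_Gam G
  let : MeasurableSpace G := borel G
  have : BorelSpace G := ⟨rfl⟩
  have hq : Continuous (Prod.map id QuotientGroup.mk : T × G → T × (G ⧸ Gam G)) :=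
    continuous_id.prodMap QuotientGroup.continuous_mk
  have hs : Function.Surjective (Prod.map id QuotientGroup.mk : T × G → T × (G ⧸ Gam G)) :=
    Function.surjective_id.prodMap QuotientGroup.mk_surjective
  rw [← hq.measurable.measurable_comp_iff_of_surjective hs]
  have : ((fun p : T × (G ⧸ Gam G) => siegel (fun v => Φ (p.1, v)) p.2) ∘
      (Prod.map id QuotientGroup.mk : T × G → T × (G ⧸ Gam G))) =
      fun p : T × G => ∑' z : {z : Fin d → ratSIntegers S // z ≠ 0},
        Φ (p.1, latVec p.2.1 z) := by
    funext p
    exact siegel_mk (fun v => Φ (p.1, v)) p.2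
  rw [this]
  refine Measurable.tsum fun z => hΦ.comp (measurable_fst.prodMk ?_)
  exact (((continuous_latVec z.1).comp continuous_subtype_val).comp continuous_snd).measurable

theorem measurable_siegel (hG : IsClosed (G : Set (GLS S d)))
    [MeasurableSpace (G ⧸ Gam G)] [BorelSpace (G ⧸ Gam G)]
    {f : (Fin d → QS S) → ℝ≥0∞} (hf : Measurable f) :
    Measurable (siegel f : G ⧸ Gam G → ℝ≥0∞) :=
  (measurable_siegel_param (T := Unit) hG (hf.comp measurable_snd)).comp
    (measurable_prodMk_left (x := ()))

/-- The intensity measure of the random set of nonzero lattice vectors, `A ↦ ∫ Ĩ_A dm`. -/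
noncomputable def intensity [MeasurableSpace (G ⧸ Gam G)] (m : Measure (G ⧸ Gam G)) :
    Measure (Fin d → QS S) :=
  m.bind fun x => Measure.sum fun v : (lattice x \ {0} : Set (Fin d → QS S)) => Measure.dirac v.1

section
variable [MeasurableSpace (G ⧸ Gam G)] [BorelSpace (G ⧸ Gam G)] {m : Measure (G ⧸ Gam G)}

theorem lintegral_intensity (hG : IsClosed (G : Set (GLS S d)))
    {f : (Fin d → QS S) → ℝ≥0∞} (hf : Measurable f) :
    ∫⁻ v, f v ∂intensity m = ∫⁻ x, siegel f x ∂m := by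
  have key : ∀ f : (Fin d → QS S) → ℝ≥0∞, Measurable f → ∀ x : G ⧸ Gam G,
      ∫⁻ v, f v ∂(Measure.sum fun v : (lattice x \ {0} : Set (Fin d → QS S)) =>
        Measure.dirac v.1) = siegel f x := by
    intro f hf x
    rw [lintegral_sum_measure, siegel]
    simp only [lintegral_dirac' _ hf]
  have hmeas : Measurable fun x : G ⧸ Gam G =>
      Measure.sum fun v : (lattice x \ {0} : Set (Fin d → QS S)) => Measure.dirac v.1 := by
    refine Measure.measurable_of_measurable_coe _ fun s hs => ?_
    have : (fun x : G ⧸ Gam G => (Measure.sum fun v : (lattice x \ {0} : Set (Fin d → QS S)) =>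
        Measure.dirac v.1) s) = siegel (s.indicator 1) := by
      funext x
      rw [← key _ (measurable_one.indicator hs), lintegral_indicator_one hs]
    rw [this]
    exact measurable_siegel hG (measurable_one.indicator hs)
  rw [intensity, Measure.lintegral_bind hmeas.aemeasurable hf.aemeasurable]
  exact lintegral_congr fun x => key f hf x

theorem intensity_apply (hG : IsClosed (G : Set (GLS S d))) {A : Set (Fin d → QS S)}
    (hA : MeasurableSet A) : intensity m A = ∫⁻ x, siegel (A.indicator 1) x ∂m := by
  rw [← lintegral_intensity hG (measurable_one.indicator hA), lintegral_indicator_one hA]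

theorem measurable_mulVec (g : GLS S d) : Measurable g.1.mulVec :=
  (Continuous.matrix_mulVec continuous_const continuous_id).measurable

theorem lintegral_intensity_mulVec [SMulInvariantMeasure G (G ⧸ Gam G) m]
    (hG : IsClosed (G : Set (GLS S d))) (g : G)
    {f : (Fin d → QS S) → ℝ≥0∞} (hf : Measurable f) :
    ∫⁻ v, f (g.1.1.mulVec v) ∂intensity m = ∫⁻ v, f v ∂intensity m := by
  have hfg : Measurable fun v => f (g.1.1.mulVec v) := hf.comp (measurable_mulVec g.1)
  rw [lintegral_intensity hG hfg, lintegral_intensity hG hf]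
  have : MeasurableConstSMul G (G ⧸ Gam G) := ⟨fun c => (continuous_const_smul c).measurable⟩
  rw [← (measurePreserving_smul g m).lintegral_comp (measurable_siegel hG hf)]
  exact lintegral_congr fun x => (siegel_smul f g x).symm

theorem lintegral_lintegral_intensity [SFinite m] (hG : IsClosed (G : Set (GLS S d)))
    {Φ : QS S × (Fin d → QS S) → ℝ≥0∞} (hΦ : Measurable Φ) :
    ∫⁻ t, ∫⁻ v, Φ (t, v) ∂intensity m ∂muQS S = ∫⁻ v, ∫⁻ t, Φ (t, v) ∂muQS S ∂intensity m := by
  have h1 : ∀ t, Measurable fun v => Φ (t, v) := fun t => hΦ.comp measurable_prodMk_left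
  have h2 : ∀ v, Measurable fun t => Φ (t, v) := fun v => hΦ.comp measurable_prodMk_right
  simp only [lintegral_intensity hG (h1 _)]
  rw [lintegral_intensity hG hΦ.lintegral_prod_left',
    lintegral_lintegral_swap (measurable_siegel_param hG hΦ).aemeasurable]
  refine lintegral_congr fun x => ?_
  obtain ⟨g, rfl⟩ := QuotientGroup.mk_surjective x
  simp only [siegel_mk]
  exact lintegral_tsum fun z => (h2 _).aemeasurable

/-- The shear `v ↦ v + t v_j e_i` as an element of the group. -/
noncomputable def shearGL (i j : Fin d) (hij : i ≠ j) (t : QS S) : GLS S d where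
  val := Matrix.transvection i j t
  inv := Matrix.transvection i j (-t)
  val_inv := by rw [Matrix.transvection_mul_transvection_same i j hij]; simp
  inv_val := by rw [Matrix.transvection_mul_transvection_same i j hij]; simp

theorem shearGL_mem_SL (i j : Fin d) (hij : i ≠ j) (t : QS S) : shearGL i j hij t ∈ SL S d := by
  rw [SL, MonoidHom.mem_ker, Units.ext_iff]
  exact Matrix.det_transvection_of_ne i j hij t

theorem shearGL_mulVec (i j : Fin d) (hij : i ≠ j) (t : QS S) (v : Fin d → QS S) :
    (shearGL i j hij t).1.mulVec v = shear i j t v := by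
  change (Matrix.transvection i j t).mulVec v = _
  rw [Matrix.transvection, Matrix.add_mulVec, Matrix.one_mulVec, Matrix.single_mulVec]
  ext1 k
  by_cases hk : k = i
  · subst hk; simp [shear]
  · simp [shear, Function.update_of_ne hk]

theorem isShearInvariant_intensity [SFinite m] [SMulInvariantMeasure G (G ⧸ Gam G) m]
    (hG : IsClosed (G : Set (GLS S d))) (hSL : SL S d ≤ G) :
    IsShearInvariant (muQS S) (intensity m) where
  lintegral_shear i j hij t f hf := by
    rw [← lintegral_intensity_mulVec hG ⟨_, hSL (shearGL_mem_SL i j hij t)⟩ hf]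
    simp only [shearGL_mulVec]
  tonelli Φ hΦ := lintegral_lintegral_intensity hG hΦ

/-- A nonzero rational vector stays nonzero at every place, also after applying `g`. -/
theorem exists_map_latVec_ne_zero {K : Type*} [Field K] (φ : QS S →+* K) (g : GLS S d)
    {z : Fin d → ratSIntegers S} (hz : z ≠ 0) : ∃ k, φ (latVec g z k) ≠ 0 := by
  by_contra! h
  apply hz
  have hinv : (g⁻¹).1.mulVec (latVec g z) = fun i => diagEmb S (z i) := by
    rw [latVec, Matrix.mulVec_mulVec, ← Units.val_mul, inv_mul_cancel, Units.val_one,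
      Matrix.one_mulVec]
  funext i
  have h1 : φ (diagEmb S (z i)) = 0 := by
    rw [← congrFun hinv i, Matrix.mulVec, dotProduct, map_sum]
    exact Finset.sum_eq_zero fun k _ => by rw [map_mul, h k, mul_zero]
  exact Subtype.ext ((φ.comp (diagEmb S)).injective (h1.trans (map_zero _).symm))

theorem ae_intensity_exists_map_ne_zero (hG : IsClosed (G : Set (GLS S d)))
    {K : Type*} [Field K] [MeasurableSpace K] [MeasurableSingletonClass K]
    (φ : QS S →+* K) (hφ : Measurable φ) : ∀ᵐ v ∂intensity m, ∃ k, φ (v k) ≠ 0 := by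
  have hm : MeasurableSet {v : Fin d → QS S | ¬ ∃ k, φ (v k) ≠ 0} := by
    have : {v : Fin d → QS S | ¬ ∃ k, φ (v k) ≠ 0} = ⋂ k, (fun v => φ (v k)) ⁻¹' {0} := by
      ext; simp
    rw [this]
    exact MeasurableSet.iInter fun k =>
      (hφ.comp (measurable_pi_apply k)) (measurableSet_singleton 0)
  rw [ae_iff, intensity_apply hG hm, ← lintegral_zero (μ := m)]
  refine lintegral_congr fun x => ?_
  obtain ⟨g, rfl⟩ := QuotientGroup.mk_surjective x
  rw [siegel_mk, ENNReal.tsum_eq_zero]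
  exact fun z => Set.indicator_of_notMem
    (s := {v : Fin d → QS S | ¬ ∃ k, φ (v k) ≠ 0})
    (not_not_intro (exists_map_latVec_ne_zero φ g.1 z.2)) _

theorem ae_intensity_isUnit [SFinite m] [SMulInvariantMeasure G (G ⧸ Gam G) m]
    (hG : IsClosed (G : Set (GLS S d))) (hSL : SL S d ≤ G) (j : Fin d) :
    ∀ᵐ v ∂intensity m, IsUnit (v j) := by
  have h := isShearInvariant_intensity (m := m) hG hSL
  have h1 := h.ae_map_ne_zero (RingHom.fst ℝ _) measurable_fst muQS_fst_fiber
    (ae_intensity_exists_map_ne_zero hG _ measurable_fst) j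
  have hp : ∀ p : S, Measurable
      ((Pi.evalRingHom (fun p : S => ℚ_[(p.1 : ℕ)]) p).comp (RingHom.snd ℝ _)) := fun p =>
    (measurable_pi_apply p).comp measurable_snd
  have h2 := fun p : S => h.ae_map_ne_zero _ (hp p) (muQS_snd_fiber p)
    (ae_intensity_exists_map_ne_zero hG _ (hp p)) j
  filter_upwards [h1, ae_all_iff.2 h2] with v hv1 hv2
  exact (isUnit_iff _).2 ⟨hv1, hv2⟩

/-- The intensity measure is a multiple, possibly infinite, of `μ`. -/
theorem intensity_eq_mul [SFinite m] [SMulInvariantMeasure G (G ⧸ Gam G) m] (hd : 2 ≤ d)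
    (hG : IsClosed (G : Set (GLS S d))) (hSL : SL S d ≤ G)
    {A : Set (Fin d → QS S)} (hA : MeasurableSet A) :
    intensity m A = intensity m (Set.univ.pi fun _ => unitBox S) * mu S d A := by
  have : Nontrivial (Fin d) := Fin.nontrivial_iff_two_le.2 hd
  have := (isShearInvariant_intensity (m := m) hG hSL).lintegral_eq (ae_intensity_isUnit hG hSL)
    measurableSet_unitBox muQS_unitBox (measurable_one.indicator hA)
  rwa [lintegral_indicator_one hA, lintegral_indicator_one hA] at this

end

/-! ### Counting lattice points in large boxes -/

/-- The box of all `v` with `|v_k|_∞ ≤ r` and `|v_k|_p ≤ s` for all `k` and all `p ∈ S`. -/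
def bigBox (S : Finset Nat.Primes) (d : ℕ) (r s : ℝ) : Set (Fin d → QS S) :=
  Set.univ.pi fun _ => Metric.closedBall 0 r ×ˢ Metric.closedBall 0 s

theorem measurableSet_bigBox (r s : ℝ) : MeasurableSet (bigBox S d r s) :=
  MeasurableSet.univ_pi fun _ => measurableSet_closedBall.prod measurableSet_closedBall

theorem mem_bigBox {r s : ℝ} {v : Fin d → QS S} :
    v ∈ bigBox S d r s ↔ ∀ k, ‖(v k).1‖ ≤ r ∧ ‖(v k).2‖ ≤ s := by
  simp [bigBox]

theorem mu_bigBox (r s : ℝ) : mu S d (bigBox S d r s) =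
    (ENNReal.ofReal (2 * r) *
      Measure.pi (fun p : S => padicHaar (p.1 : ℕ)) (Metric.closedBall 0 s)) ^ d := by
  simp [bigBox, mu, muQS, Measure.pi_pi, Measure.prod_prod, Real.volume_closedBall]

theorem one_le_pi_padicHaar_closedBall {s : ℝ} (hs : 1 ≤ s) :
    1 ≤ Measure.pi (fun p : S => padicHaar (p.1 : ℕ)) (Metric.closedBall 0 s) := by
  have h : Measure.pi (fun p : S => padicHaar (p.1 : ℕ)) (Metric.closedBall 0 1) = 1 := by
    rw [Measure.pi_closedBall _ _ zero_le_one]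
    exact Finset.prod_eq_one fun p _ => padicHaar_closedBall_one _
  rw [← h]
  exact measure_mono (Metric.closedBall_subset_closedBall hs)

/-- The image under `g` of the fundamental domain `([0, 1) × ∏ ℤ_p) ^ d` of `ℤ_S ^ d`. -/
def domain (g : GLS S d) : Set (Fin d → QS S) :=
  (g⁻¹).1.mulVec ⁻¹' Set.univ.pi fun _ => unitBox S

theorem measurableSet_domain (g : GLS S d) : MeasurableSet (domain g) :=
  measurable_mulVec _ (MeasurableSet.univ_pi fun _ => measurableSet_unitBox)

theorem mulVec_mulVec_inv (g : GLS S d) (v : Fin d → QS S) :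
    g.1.mulVec ((g⁻¹).1.mulVec v) = v := by
  rw [Matrix.mulVec_mulVec, ← Units.val_mul, mul_inv_cancel, Units.val_one, Matrix.one_mulVec]

theorem exists_sub_mem_domain (g : GLS S d) (y : Fin d → QS S) :
    ∃ z : Fin d → ratSIntegers S, y - latVec g z ∈ domain g := by
  choose x hx hxu using fun k => exists_sub_mem_unitBox ((g⁻¹).1.mulVec y k)
  choose z hz hzx using hx
  refine ⟨fun k => ⟨z k, hz k⟩, fun k _ => ?_⟩
  have h : (g⁻¹).1.mulVec (latVec g fun k => ⟨z k, hz k⟩) = x := by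
    rw [latVec, Matrix.mulVec_mulVec, ← Units.val_mul, inv_mul_cancel, Units.val_one,
      Matrix.one_mulVec]
    exact funext hzx
  rw [Matrix.mulVec_sub, h]
  exact hxu k

theorem isBounded_domain (g : GLS S d) : ∃ r : ℝ, domain g ⊆ Metric.closedBall 0 r := by
  have hc : Continuous g.1.mulVec := Continuous.matrix_mulVec continuous_const continuous_id
  obtain ⟨r, hr⟩ :=
    ((isCompact_closedBall (0 : Fin d → QS S) 1).image hc).isBounded.subset_closedBall 0
  refine ⟨r, fun v hv => hr ⟨(g⁻¹).1.mulVec v, ?_, mulVec_mulVec_inv g v⟩⟩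
  rw [mem_closedBall_zero_iff, pi_norm_le_iff_of_nonneg zero_le_one]
  intro k
  obtain ⟨h1, h2⟩ := hv k trivial
  rw [Prod.norm_def]
  refine max_le ?_ ((pi_norm_le_iff_of_nonneg zero_le_one).2 fun p => ?_)
  · rw [Real.norm_eq_abs, abs_of_nonneg h1.1]
    exact h1.2.le
  · exact mem_closedBall_zero_iff.1 (h2 p trivial)

/-- The translates of `domain g` by the lattice vectors in a box cover a slightly smaller box; by
the ultrametric inequality only the real radius has to shrink. -/
theorem mu_bigBox_le {g : G} {r : ℝ} (hr : domain g.1 ⊆ Metric.closedBall 0 r) {R : ℝ}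
    (hR : r ≤ R) :
    mu S d (bigBox S d (R - r) R) ≤ mu S d (domain g.1) +
      siegel ((bigBox S d R R).indicator 1) (QuotientGroup.mk g : G ⧸ Gam G) *
        mu S d (domain g.1) := by
  classical
  let Z := {z : Fin d → ratSIntegers S // z ≠ 0}
  let D : Z → Set (Fin d → QS S) := fun z =>
    if latVec g.1 z ∈ bigBox S d R R then (fun y => -latVec g.1 z + y) ⁻¹' domain g.1 else ∅
  have hcover : bigBox S d (R - r) R ⊆ domain g.1 ∪ ⋃ z, D z := by
    intro y hy
    obtain ⟨z, hz⟩ := exists_sub_mem_domain g.1 y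
    by_cases hz0 : z = 0
    · left
      rwa [hz0, latVec_zero, sub_zero] at hz
    · refine Or.inr (Set.mem_iUnion.2 ⟨⟨z, hz0⟩, ?_⟩)
      have hmem : latVec g.1 z ∈ bigBox S d R R := by
        refine mem_bigBox.2 fun k => ?_
        have hu := mem_closedBall_zero_iff.1 (hr hz)
        have huk := (norm_le_pi_norm _ k).trans hu
        rw [Prod.norm_def, max_le_iff] at huk
        obtain ⟨h1, h2⟩ := mem_bigBox.1 hy k
        have he : latVec g.1 z k = y k - (y - latVec g.1 z) k := by simp
        rw [he]
        constructor
        · calc ‖(y k).1 - ((y - latVec g.1 z) k).1‖ ≤ ‖(y k).1‖ + ‖((y - latVec g.1 z) k).1‖ :=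
              norm_sub_le _ _
            _ ≤ R := by linarith [huk.1]
        · refine (pi_norm_le_iff_of_nonneg ((norm_nonneg _).trans h2)).2 fun p => ?_
          change ‖(y k).2 p - ((y - latVec g.1 z) k).2 p‖ ≤ R
          rw [sub_eq_add_neg]
          refine (Padic.nonarchimedean _ _).trans (max_le ((norm_le_pi_norm _ p).trans h2) ?_)
          rw [norm_neg]
          exact (norm_le_pi_norm _ p).trans (huk.2.trans hR)
      simp only [D, hmem, if_true, Set.mem_preimage]
      rwa [neg_add_eq_sub]
  have hD : ∀ z : Z, mu S d (D z) =
      (bigBox S d R R).indicator 1 (latVec g.1 z) * mu S d (domain g.1) := by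
    intro z
    by_cases hz : latVec g.1 z ∈ bigBox S d R R
    · simp only [D, hz, if_true, Set.indicator_of_mem, Pi.one_apply, one_mul]
      exact measure_preimage_add _ _ _
    · simp [D, hz]
  calc mu S d (bigBox S d (R - r) R) ≤ mu S d (domain g.1) + mu S d (⋃ z, D z) :=
        (measure_mono hcover).trans (measure_union_le _ _)
    _ ≤ mu S d (domain g.1) + ∑' z, mu S d (D z) := by gcongr; exact measure_iUnion_le _
    _ = _ := by
        rw [siegel_mk, ← ENNReal.tsum_mul_right]
        simp only [hD, Z]

open Filter Topology

theorem tendsto_mu_bigBox_atTop (hd : d ≠ 0) :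
    Tendsto (fun n : ℕ => mu S d (bigBox S d n n)) atTop (𝓝 ∞) := by
  have h1 : Tendsto (fun n : ℕ => (n : ℝ≥0∞)) atTop (𝓝 ∞) := ENNReal.tendsto_nat_nhds_top
  refine tendsto_nhds_top_mono h1 ?_
  filter_upwards [eventually_ge_atTop 1] with n hn
  have hw := one_le_pi_padicHaar_closedBall (S := S) (s := (n : ℝ)) (by exact_mod_cast hn)
  have h2 : (n : ℝ≥0∞) ≤ ENNReal.ofReal (2 * n) := by
    rw [← ENNReal.ofReal_natCast]
    exact ENNReal.ofReal_le_ofReal (by linarith [(Nat.cast_nonneg n : (0 : ℝ) ≤ n)])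
  rw [mu_bigBox]
  have h3 : (n : ℝ≥0∞) ≤ ENNReal.ofReal (2 * n) *
      Measure.pi (fun p : S => padicHaar (p.1 : ℕ)) (Metric.closedBall 0 (n : ℝ)) := by
    calc (n : ℝ≥0∞) = n * 1 := (mul_one _).symm
      _ ≤ _ := mul_le_mul' h2 hw
  exact h3.trans (le_self_pow (le_trans (by exact_mod_cast hn) h3) hd)

theorem mu_bigBox_ne_zero {n : ℕ} (hn : 1 ≤ n) : mu S d (bigBox S d n n) ≠ 0 := by
  rw [mu_bigBox]
  refine pow_ne_zero _ (mul_ne_zero ?_ ?_)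
  · rw [Ne, ENNReal.ofReal_eq_zero, not_le]
    have : (1 : ℝ) ≤ n := by exact_mod_cast hn
    linarith
  · exact (zero_lt_one.trans_le (one_le_pi_padicHaar_closedBall (by exact_mod_cast hn))).ne'

theorem mu_bigBox_ne_top (r s : ℝ) : mu S d (bigBox S d r s) ≠ ∞ := by
  rw [mu_bigBox]
  exact ENNReal.pow_ne_top (ENNReal.mul_ne_top ENNReal.ofReal_ne_top
    (isCompact_closedBall _ _).measure_ne_top)

theorem tendsto_mu_bigBox_div (r : ℝ) :
    Tendsto (fun n : ℕ => mu S d (bigBox S d (n - r) n) / mu S d (bigBox S d n n)) atTop (𝓝 1) := by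
  have h1 : Tendsto (fun n : ℕ => ENNReal.ofReal (1 - r / n) ^ d) atTop (𝓝 1) := by
    have h0 : Tendsto (fun n : ℕ => 1 - r / (n : ℝ)) atTop (𝓝 (1 - 0)) :=
      tendsto_const_nhds.sub (tendsto_const_div_atTop_nhds_zero_nat r)
    have := ENNReal.Tendsto.pow (n := d) (ENNReal.tendsto_ofReal h0)
    simpa using this
  refine h1.congr' ?_
  filter_upwards [eventually_ge_atTop 1] with n hn
  have hn0 : (0 : ℝ) < n := by exact_mod_cast hn
  have hb0 := mu_bigBox_ne_zero (S := S) (d := d) hn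
  rw [ENNReal.eq_div_iff hb0 (mu_bigBox_ne_top _ _), mu_bigBox, mu_bigBox, ← mul_pow,
    mul_right_comm, ← ENNReal.ofReal_mul (by positivity)]
  congr 3
  field_simp

/-- The lattice `g ℤ_S ^ d` has lower density at least `1 / μ (g D)`, where `D` is the fundamental
domain of `ℤ_S ^ d`. -/
theorem inv_mu_domain_le_liminf (hd : d ≠ 0) (g : G) :
    (mu S d (domain g.1))⁻¹ ≤ liminf (fun n : ℕ =>
      siegel ((bigBox S d n n).indicator 1) (QuotientGroup.mk g : G ⧸ Gam G) /
        mu S d (bigBox S d n n)) atTop := by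
  obtain ⟨r, hr⟩ := isBounded_domain g.1
  set κ := mu S d (domain g.1) with hκ
  have hκtop : κ ≠ ∞ := (measure_mono hr).trans_lt
    (isCompact_closedBall _ _).measure_lt_top |>.ne
  have h1 : Tendsto (fun n : ℕ => (mu S d (bigBox S d (n - r) n) / mu S d (bigBox S d n n) -
      κ / mu S d (bigBox S d n n)) / κ) atTop (𝓝 ((1 - 0) / κ)) := by
    refine ENNReal.Tendsto.div_const (ENNReal.Tendsto.sub (tendsto_mu_bigBox_div r) ?_
      (Or.inl ENNReal.one_ne_top)) (Or.inl (by simp))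
    rw [← ENNReal.div_top (a := κ)]
    exact ENNReal.Tendsto.const_div (tendsto_mu_bigBox_atTop hd) (Or.inr hκtop)
  rw [tsub_zero, one_div] at h1
  rw [← h1.liminf_eq]
  refine liminf_le_liminf ?_
  filter_upwards [eventually_ge_atTop ⌈r⌉₊] with n hn
  refine ENNReal.div_le_of_le_mul ?_
  rw [tsub_le_iff_left, ← ENNReal.mul_div_right_comm, ← ENNReal.add_div]
  gcongr
  exact mu_bigBox_le hr (Nat.ceil_le.1 hn)

/-! ### The mean value inequality -/

section
variable [MeasurableSpace (G ⧸ Gam G)] [BorelSpace (G ⧸ Gam G)] {m : Measure (G ⧸ Gam G)}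
  [IsProbabilityMeasure m] [SMulInvariantMeasure G (G ⧸ Gam G) m]

/-- The proportionality constant between the intensity measure and `μ` is at least `1`. It is
bounded below by the mean density of the lattices, which is positive. So if it is finite, then `μ`
is `G`-invariant because the intensity measure is, and all lattices have covolume `1`. -/
theorem one_le_intensity_unitBox (hd : 2 ≤ d)
    (hG : IsClosed (G : Set (GLS S d))) (hSL : SL S d ≤ G) :
    1 ≤ intensity m (Set.univ.pi fun _ => unitBox S) := by
  set c := intensity m (Set.univ.pi fun _ => unitBox S) with hc
  let Y : ℕ → G ⧸ Gam G → ℝ≥0∞ := fun n x =>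
    siegel ((bigBox S d n n).indicator 1) x / mu S d (bigBox S d n n)
  have hsm : ∀ n : ℕ, Measurable
      (siegel ((bigBox S d n n).indicator 1) : G ⧸ Gam G → ℝ≥0∞) := fun n =>
    measurable_siegel hG (measurable_one.indicator (measurableSet_bigBox _ _))
  have hY : ∀ n : ℕ, 1 ≤ n → ∫⁻ x, Y n x ∂m = c := by
    intro n hn
    simp only [Y, ENNReal.div_eq_inv_mul]
    rw [lintegral_const_mul _ (hsm n), ← intensity_apply hG (measurableSet_bigBox _ _),
      intensity_eq_mul hd hG hSL (measurableSet_bigBox _ _), mul_comm, mul_assoc,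
      ENNReal.mul_inv_cancel (mu_bigBox_ne_zero hn) (mu_bigBox_ne_top _ _), mul_one]
  have hfatou : ∫⁻ x, liminf (fun n => Y n x) atTop ∂m ≤ c := by
    refine (lintegral_liminf_le fun n => (hsm n).div_const _).trans_eq ?_
    refine Tendsto.liminf_eq (tendsto_const_nhds.congr' ?_)
    filter_upwards [eventually_ge_atTop 1] with n hn using (hY n hn).symm
  have hlow : ∀ g : G, (mu S d (domain g.1))⁻¹ ≤
      liminf (fun n => Y n (QuotientGroup.mk g)) atTop := fun g =>
    inv_mu_domain_le_liminf (by omega) g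
  have hfin : ∀ g : G, mu S d (domain g.1) ≠ ∞ := fun g => by
    obtain ⟨r, hr⟩ := isBounded_domain g.1
    exact ((measure_mono hr).trans_lt (isCompact_closedBall _ _).measure_lt_top).ne
  have hc0 : c ≠ 0 := by
    intro h0
    rw [h0, nonpos_iff_eq_zero,
      lintegral_eq_zero_iff (Measurable.liminf fun n => (hsm n).div_const _)] at hfatou
    obtain ⟨x, hx⟩ := hfatou.exists
    obtain ⟨g, rfl⟩ := QuotientGroup.mk_surjective x
    have := (hlow g).trans_eq hx
    simp only [Pi.zero_apply, nonpos_iff_eq_zero, ENNReal.inv_eq_zero] at this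
    exact hfin g this
  by_cases hctop : c = ∞
  · rw [hctop]; exact le_top
  have hD : ∀ g : G, mu S d (domain g.1) = 1 := by
    intro g
    have h1 : intensity m (domain g.1) = c := by
      have hU : MeasurableSet (Set.univ.pi fun _ : Fin d => unitBox S) :=
        MeasurableSet.univ_pi fun _ => measurableSet_unitBox
      have := lintegral_intensity_mulVec (m := m) hG g⁻¹ (measurable_one.indicator hU)
      rw [lintegral_indicator_one hU] at this
      rw [hc, ← this, ← lintegral_indicator_one (measurableSet_domain g.1)]
      rfl
    rw [intensity_eq_mul hd hG hSL (measurableSet_domain g.1), ← hc] at h1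
    exact (ENNReal.mul_right_inj hc0 hctop).1 (h1.trans (mul_one c).symm)
  refine le_trans ?_ hfatou
  calc (1 : ℝ≥0∞) = ∫⁻ _ : G ⧸ Gam G, 1 ∂m := by simp
    _ ≤ _ := by
      refine lintegral_mono fun x => ?_
      obtain ⟨g, rfl⟩ := QuotientGroup.mk_surjective x
      have := hlow g
      rwa [hD g, inv_one] at this

/-- The half of Siegel's mean value formula that gives many lattice points on average. -/
theorem mu_le_lintegral_siegel (hd : 2 ≤ d)
    (hG : IsClosed (G : Set (GLS S d))) (hSL : SL S d ≤ G)
    {A : Set (Fin d → QS S)} (hA : MeasurableSet A) :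
    mu S d A ≤ ∫⁻ x, siegel (A.indicator 1) x ∂m := by
  rw [← intensity_apply hG hA, intensity_eq_mul hd hG hSL hA]
  exact le_mul_of_one_le_left' (one_le_intensity_unitBox hd hG hSL)

end

end SArithmetic

/-! ### Lattices that miss a set -/

/-- Chebyshev's inequality in `[0, ∞]`, which needs only a lower bound for the mean. -/
theorem measure_eq_zero_le_of_second_moment {Ω : Type*} [MeasurableSpace Ω] {m : Measure Ω}
    [IsProbabilityMeasure m] {X : Ω → ℝ≥0∞} (hX : Measurable X) {a K : ℝ≥0∞} (ha0 : a ≠ 0)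
    (ha : a ≠ ∞) (h1 : a ≤ ∫⁻ x, X x ∂m) (h2 : ∫⁻ x, X x ^ 2 ∂m ≤ a ^ 2 + K * a) :
    m {x | X x = 0} ≤ K / a := by
  have hs : MeasurableSet {x | X x = 0} := hX (measurableSet_singleton 0)
  -- the integrated form of `(X - a) ^ 2 ≥ a ^ 2 1_{X = 0}`
  have hpt : ∀ x, 2 * a * X x + a ^ 2 * {x | X x = 0}.indicator 1 x ≤ X x ^ 2 + a ^ 2 := by
    intro x
    by_cases hx : X x = 0
    · simp [hx]
    · rw [Set.indicator_of_notMem (s := {x | X x = 0}) hx, mul_zero, add_zero, mul_right_comm]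
      rcases eq_or_ne (X x) ∞ with hx' | hx'
      · simp [hx']
      lift X x to NNReal using hx' with y
      lift a to NNReal using ha with b
      exact_mod_cast two_mul_le_add_sq y b
  have hint := lintegral_mono (μ := m) hpt
  rw [lintegral_add_left (hX.const_mul _), lintegral_const_mul _ hX,
    lintegral_const_mul _ (measurable_one.indicator hs), lintegral_indicator_one hs,
    lintegral_add_right _ measurable_const, lintegral_const, measure_univ, mul_one] at hint
  have h3 : 2 * a * a + a ^ 2 * m {x | X x = 0} ≤ 2 * a * a + K * a := by
    calc 2 * a * a + a ^ 2 * m {x | X x = 0}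
        ≤ 2 * a * (∫⁻ x, X x ∂m) + a ^ 2 * m {x | X x = 0} := by gcongr
      _ ≤ _ := hint
      _ ≤ a ^ 2 + K * a + a ^ 2 := by gcongr
      _ = 2 * a * a + K * a := by ring
  have h4 : a ^ 2 * m {x | X x = 0} ≤ K * a :=
    (ENNReal.add_le_add_iff_left
      (ENNReal.mul_ne_top (ENNReal.mul_ne_top ENNReal.ofNat_ne_top ha) ha)).1 h3
  rw [ENNReal.le_div_iff_mul_le (Or.inl ha0) (Or.inl ha)]
  refine (ENNReal.mul_le_mul_iff_left ha0 ha).1 ?_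
  calc m {x | X x = 0} * a * a = a ^ 2 * m {x | X x = 0} := by ring
    _ ≤ K * a := h4

theorem mainTheorem8 (S : Finset Nat.Primes) (d : ℕ) (hd : 2 ≤ d)
    (G : Subgroup (SArithmetic.GLS S d))
    (hG : G = SArithmetic.UL S d ∨ G = SArithmetic.SL S d)
    [MeasurableSpace (G ⧸ SArithmetic.Gam G)] [BorelSpace (G ⧸ SArithmetic.Gam G)]
    (m : Measure (G ⧸ SArithmetic.Gam G)) [IsProbabilityMeasure m]
    [SMulInvariantMeasure G (G ⧸ SArithmetic.Gam G) m]
    (F : Set (Set (Fin d → SArithmetic.QS S)))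
    (hF : ∀ A ∈ F, NullMeasurableSet A (SArithmetic.mu S d) ∧
      0 < SArithmetic.mu S d A ∧ SArithmetic.mu S d A < ∞)
    (C : ℝ) (hC : 0 < C)
    (hmoment : ∀ A ∈ F,
      ∫⁻ x, SArithmetic.siegel (A.indicator 1) x ^ 2 ∂m ≤
        SArithmetic.mu S d A ^ 2 + ENNReal.ofReal C * SArithmetic.mu S d A) :
    ∀ A ∈ F,
      m {x | (SArithmetic.lattice x \ {0}) ∩ A = ∅} ≤
        ENNReal.ofReal C / SArithmetic.mu S d A := by
  intro A hA
  obtain ⟨hnull, h0, htop⟩ := hF A hA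
  have hcl : IsClosed (G : Set (SArithmetic.GLS S d)) := by
    rcases hG with rfl | rfl
    exacts [SArithmetic.isClosed_UL, SArithmetic.isClosed_SL]
  have hSL : SArithmetic.SL S d ≤ G := by
    rcases hG with rfl | rfl
    exacts [SArithmetic.SL_le_UL S d, le_rfl]
  -- shrinking `A` to a Borel set only weakens the moment bound and enlarges the event
  obtain ⟨B, hBA, hB, hBae⟩ := hnull.exists_measurable_subset_ae_eq
  have hmu : SArithmetic.mu S d B = SArithmetic.mu S d A := measure_congr hBae
  have hsub : {x : G ⧸ SArithmetic.Gam G | (SArithmetic.lattice x \ {0}) ∩ A = ∅} ⊆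
      {x | SArithmetic.siegel (B.indicator 1) x = 0} := by
    intro x hx
    refine ENNReal.tsum_eq_zero.2 fun v => Set.indicator_of_notMem (fun hv => ?_) _
    exact Set.eq_empty_iff_forall_notMem.1 hx v.1 ⟨v.2, hBA hv⟩
  refine (measure_mono hsub).trans (measure_eq_zero_le_of_second_moment
    (SArithmetic.measurable_siegel hcl (measurable_one.indicator hB)) h0.ne' htop.ne ?_ ?_)
  · rw [← hmu]
    exact SArithmetic.mu_le_lintegral_siegel hd hcl hSL hB
  · refine (lintegral_mono fun x => ?_).trans (hmoment A hA)
    gcongr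
    exact SArithmetic.siegel_mono
      (Set.indicator_le_indicator_of_subset hBA fun _ => zero_le) x
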